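/- Consider Euler's two-center problem with primaries $E=(-1,0)$ and $M=(1,0)$ of masses $1-\mu$ and $\mu$, $\mu\in(0,1)$, at an energy $c<0$. In elliptic coordinates $(\lambda,\nu)\in\mathbb{R}\times\mathbb{R}/2\pi\mathbb{Z}$, $q_1=\cosh\lambda\cos\nu$, $q_2=\sinh\lambda\sin\nu$, the regularized Hamiltonian is $$F_{\mu,c}=F_\lambda+F_\nu,\qquad F_\lambda=\tfrac12p_\lambda^2-\cosh\lambda-c\cosh^2\lambda,\qquad F_\nu=\tfrac12p_\nu^2+(1-2\mu)\cos\nu+c\cos^2\nu ,$$ and trajectories are those of $F_{\mu,c}$ on the level $F_{\mu,c}=0$. A trajectory is a lemniscate motion if, for the value $g=F_\nu=-F_\lambda$ of the first integral, $\lambda$ oscillates in an interval $[-\lambda_0,\lambda_0]$, $\lambda_0>0$, with turning points only at $\pm\lambda_0$ (that is, $-g+\cosh\lambda+c\cosh^2\lambda$ is positive for $|\lambda|<\lambda_0$, zero for $|\lambda|=\lambda_0$ and negative for $|\lambda|>\lambda_0$), while $\nu$ is unrestricted and has no turning points (that is, $g-(1-2\mu)\cos\nu-c\cos^2\nu>0$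 for all $\nu$). For relatively prime positive integers $k,l$, such a trajectory lies on a $T_{k,l}$-torus if $T_\nu/T_\lambda=k/l$, where $T_\lambda,T_\nu$ are the minimal periods of the motions $(\lambda,p_\lambda)$ and $(\nu \bmod 2\pi,p_\nu)$. A collision-collision orbit is a periodic orbit that undergoes two collisions with $\{E,M\}$ within one minimal period (with the same primary or with different ones); it retraces its path after each collision. Its self-intersection points are the points of the $q$-plane that it visits at two different times $s<t$ with no collision during $[s,t]$. Let $k,l$ be relatively prime positive integers. Every collision-collision orbit that is a lemniscate motion lying on a $T_{k,l}$-torus has exactly $N$ self-intersection points, where $$N=\begin{cases}\dfrac{k(l-1)}{2}-\dfrac12 & \text{if } l \text{ is even},\\[2mm] \dfrac{k(l-1)}{2} & \text{if } l \text{ is odd}.\end{cases}$$ -/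

import Mathlib

namespace EulerProblem

/-- The primary `E = (-1, 0)`, of mass `1 - μ`. -/
def primaryE : ℝ × ℝ := (-1, 0)

/-- The primary `M = (1, 0)`, of mass `μ`. -/
def primaryM : ℝ × ℝ := (1, 0)

/-- The point of the `q`-plane with elliptic coordinates `(x, y) = (λ, ν)`. -/
noncomputable def ellipticPoint (x y : ℝ) : ℝ × ℝ :=
  (Real.cosh x * Real.cos y, Real.sinh x * Real.sin y)

/-- `F_λ = p_λ² / 2 - cosh λ - c cosh² λ`. -/
noncomputable def Flam (c x px : ℝ) : ℝ :=
  px ^ 2 / 2 - Real.cosh x - c * Real.cosh x ^ 2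

/-- `F_ν = p_ν² / 2 + (1 - 2 μ) cos ν + c cos² ν`. -/
noncomputable def Fnu (μ c y py : ℝ) : ℝ :=
  py ^ 2 / 2 + (1 - 2 * μ) * Real.cos y + c * Real.cos y ^ 2

/-- The regularized Hamiltonian `F_{μ,c} = (H - c) (cosh² λ - cos² ν) = F_λ + F_ν` of Euler's
two-center problem at energy `c`, in elliptic coordinates. -/
noncomputable def F (μ c x y px py : ℝ) : ℝ := Flam c x px + Fnu μ c y py

/-- A curve `(λ(t), ν(t), p_λ(t), p_ν(t))`. The coordinate `ν` takes values in `ℝ / 2πℤ`; the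
field `nu` is a real-valued lift of it. -/
structure PhaseCurve where
  lam : ℝ → ℝ
  nu : ℝ → ℝ
  plam : ℝ → ℝ
  pnu : ℝ → ℝ

/-- Hamiltonian trajectories of `F_{μ,c}` on the regularized energy level `F_{μ,c} = 0`. -/
structure IsTrajectory (μ c : ℝ) (γ : PhaseCurve) : Prop where
  hasDerivAt_lam : ∀ t, HasDerivAt γ.lam
    (deriv (fun p => F μ c (γ.lam t) (γ.nu t) p (γ.pnu t)) (γ.plam t)) t
  hasDerivAt_nu : ∀ t, HasDerivAt γ.nu
    (deriv (fun p => F μ c (γ.lam t) (γ.nu t) (γ.plam t) p) (γ.pnu t)) t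
  hasDerivAt_plam : ∀ t, HasDerivAt γ.plam
    (-deriv (fun x => F μ c x (γ.nu t) (γ.plam t) (γ.pnu t)) (γ.lam t)) t
  hasDerivAt_pnu : ∀ t, HasDerivAt γ.pnu
    (-deriv (fun y => F μ c (γ.lam t) y (γ.plam t) (γ.pnu t)) (γ.nu t)) t
  level : ∀ t, F μ c (γ.lam t) (γ.nu t) (γ.plam t) (γ.pnu t) = 0

/-- The value of `p_λ² / 2` at the position `λ = x` on the torus `F_λ = -g`, `F_ν = g`. -/
noncomputable def kineticLam (c g x : ℝ) : ℝ := -g - Flam c x 0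

/-- The value of `p_ν² / 2` at the position `ν = y` on the torus `F_λ = -g`, `F_ν = g`. -/
noncomputable def kineticNu (μ c g y : ℝ) : ℝ := g - Fnu μ c y 0

/-- `(g, c)` lies in the (open) lemniscate region: `λ` oscillates in an interval `[-λ₀, λ₀]`, with
turning points only at its end points, and `ν` is unrestricted, without turning points. -/
def InLemniscateRegion (μ c g : ℝ) : Prop :=
  (∃ x₀ : ℝ, 0 < x₀ ∧ {x | 0 ≤ kineticLam c g x} = Set.Icc (-x₀) x₀ ∧
    ∀ x ∈ Set.Ioo (-x₀) x₀, 0 < kineticLam c g x) ∧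
  ∀ y, 0 < kineticNu μ c g y

/-- `γ` is a lemniscate motion: the value `g` of the first integral `G` along `γ` is such that
`(g, c)` lies in the lemniscate region. On the level `F_{μ,c} = 0` one has `G = F_ν = -F_λ`. -/
def IsLemniscate (μ c : ℝ) (γ : PhaseCurve) : Prop :=
  ∃ g, (∀ t, Fnu μ c (γ.nu t) (γ.pnu t) = g) ∧ InLemniscateRegion μ c g

/-- `T` is the minimal positive period of `f`. -/
def IsMinimalPeriod {α : Type*} (f : ℝ → α) (T : ℝ) : Prop :=
  IsLeast {T : ℝ | 0 < T ∧ Function.Periodic f T} T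

/-- The motion in `λ`. -/
def PhaseCurve.lamMotion (γ : PhaseCurve) (t : ℝ) : ℝ × ℝ := (γ.lam t, γ.plam t)

/-- The motion in `ν`, where `ν` is taken modulo `2π`. -/
noncomputable def PhaseCurve.nuMotion (γ : PhaseCurve) (t : ℝ) : Real.Angle × ℝ :=
  ((γ.nu t : Real.Angle), γ.pnu t)

/-- `γ` lies on a `T_{k,l}`-torus: the rotation number `R = T_ν / T_λ` equals `k / l`. -/
def LiesOnTorus (k l : ℕ) (γ : PhaseCurve) : Prop :=
  ∃ Tlam Tnu : ℝ, IsMinimalPeriod γ.lamMotion Tlam ∧ IsMinimalPeriod γ.nuMotion Tnu ∧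
    Tnu / Tlam = (k : ℝ) / (l : ℝ)

/-- The projection of `γ` to the `q`-plane. -/
noncomputable def PhaseCurve.pos (γ : PhaseCurve) (t : ℝ) : ℝ × ℝ :=
  ellipticPoint (γ.lam t) (γ.nu t)

/-- `γ` is at a collision with `E` or `M` at time `t`. -/
def PhaseCurve.CollidesAt (γ : PhaseCurve) (t : ℝ) : Prop :=
  γ.pos t = primaryE ∨ γ.pos t = primaryM

/-- Collision-collision orbits: periodic orbits which undergo two collisions within one minimal
period, with the same primary or with different ones. -/
def IsCollisionCollision (γ : PhaseCurve) : Prop :=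
  ∃ T, IsMinimalPeriod (fun t => (γ.lamMotion t, γ.nuMotion t)) T ∧
    ∃ a b, a < b ∧ b < a + T ∧ γ.CollidesAt a ∧ γ.CollidesAt b

/-- The self-intersection points of a collision-collision orbit in the `q`-plane. At a collision
such an orbit turns back and retraces its path, so that every point of it is visited several
times; the self-intersection points are the points visited at two different times of one and
the same arc between consecutive collisions. -/
def PhaseCurve.selfIntersectionPoints (γ : PhaseCurve) : Set (ℝ × ℝ) :=
  {q | ∃ s t, s < t ∧ γ.pos s = q ∧ γ.pos t = q ∧ ∀ r ∈ Set.Icc s t, ¬ γ.CollidesAt r}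

end EulerProblem

namespace EulerProblem

/-! ### Newton equations: uniqueness and symmetries -/

open Set

/-! The motion separates into an oscillation in λ and a rotation in ν, each solving a Newton
equation with odd force. Start at a collision time `a`, where λ = 0 and ν is 0 or π. Reversing time
about `a` then negates both coordinates (ν modulo 2π). Write the periods of λ and ν as lτ and kτ.

A point of the `q`-plane determines (λ, ν) up to a simultaneous sign. So equality of positions at
times s, t becomes arithmetic: t - s and s + t - 2a must lie in prescribed sets of multiples of kτ
and lτ, integral or half-integral (`PhaseCurve.HasTorusTimes`). Collisions occur exactly at a +
(klτ/2)ℤ. Inside one arc the only coincidences left are those where one of t - s, s + t - 2a is jkτ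
and the other is (m + 1/2)lτ. In both cases the later time is a + τ(2jk + (2m+1)l)/4, so
self-intersections correspond to lattice points with 2jk + (2m+1)l < 2kl
(`selfIntersectionPoints_eq`, `injOn_latticePairs`).

These fill half of a k × (l-1) box, up to a central point on the boundary line, which is a lattice
point exactly when l is even (`card_latticePairs`). -/

theorem eq_of_hasDerivAt_of_contDiff {E : Type*} [NormedAddCommGroup E] [NormedSpace ℝ E]
    {v : E → E} (hv : ContDiff ℝ 1 v) {f g : ℝ → E} (hf : ∀ t, HasDerivAt f (v (f t)) t)
    (hg : ∀ t, HasDerivAt g (v (g t)) t) {t₀ : ℝ} (h : f t₀ = g t₀) : f = g := by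
  ext t
  obtain ⟨A, B, ht, ht₀⟩ : ∃ A B, t ∈ Ioo A B ∧ t₀ ∈ Ioo A B :=
    ⟨min t t₀ - 1, max t t₀ + 1, by grind, by grind⟩
  have hfc : Continuous f := continuous_iff_continuousAt.2 fun t => (hf t).continuousAt
  have hgc : Continuous g := continuous_iff_continuousAt.2 fun t => (hg t).continuousAt
  -- The field is only locally Lipschitz; compactness of both traces over `[A, B]` supplies one
  -- constant.
  have hcomp : IsCompact (f '' Icc A B ∪ g '' Icc A B) :=
    (isCompact_Icc.image hfc).union (isCompact_Icc.image hgc)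
  obtain ⟨K, hK⟩ := LocallyLipschitzOn.exists_lipschitzOnWith_of_compact hcomp
    hv.locallyLipschitz.locallyLipschitzOn
  exact ODE_solution_unique_of_mem_Ioo (v := fun _ => v) (fun _ _ => hK) ht₀
    (fun t ht => ⟨hf t, Or.inl (mem_image_of_mem f (Ioo_subset_Icc_self ht))⟩)
    (fun t ht => ⟨hg t, Or.inr (mem_image_of_mem g (Ioo_subset_Icc_self ht))⟩) h ht

/-- `x` is a solution of Newton's equation `x'' = f x`, with velocity `p`. -/
structure IsNewtonSolution (f x p : ℝ → ℝ) : Prop where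
  hasDerivAt_pos : ∀ t, HasDerivAt x (p t) t
  hasDerivAt_vel : ∀ t, HasDerivAt p (f (x t)) t

namespace IsNewtonSolution

variable {f x p y q : ℝ → ℝ}

theorem comp_add_const (h : IsNewtonSolution f x p) (b : ℝ) :
    IsNewtonSolution f (fun t => x (t + b)) (fun t => p (t + b)) :=
  ⟨fun t => (h.hasDerivAt_pos (t + b)).comp_add_const t b,
    fun t => (h.hasDerivAt_vel (t + b)).comp_add_const t b⟩

theorem comp_const_sub (h : IsNewtonSolution f x p) (b : ℝ) :
    IsNewtonSolution f (fun t => x (b - t)) (fun t => -p (b - t)) :=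
  ⟨fun t => (h.hasDerivAt_pos (b - t)).comp_const_sub b t,
    fun t => by
    have := ((h.hasDerivAt_vel (b - t)).comp_const_sub b t).fun_neg
    rwa [neg_neg] at this⟩

theorem neg (h : IsNewtonSolution f x p) (hf : f.Odd) :
    IsNewtonSolution f (fun t => -x t) (fun t => -p t) :=
  ⟨fun t => (h.hasDerivAt_pos t).neg, fun t => by
    rw [hf]
    exact (h.hasDerivAt_vel t).neg⟩

theorem add_const (h : IsNewtonSolution f x p) {b : ℝ} (hf : f.Periodic b) :
    IsNewtonSolution f (fun t => x t + b) p :=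
  ⟨fun t => (h.hasDerivAt_pos t).add_const b, fun t => by
    rw [hf]
    exact h.hasDerivAt_vel t⟩

theorem unique (h : IsNewtonSolution f x p) (h' : IsNewtonSolution f y q)
    (hf : ContDiff ℝ 1 f) {t₀ : ℝ} (hx : x t₀ = y t₀) (hp : p t₀ = q t₀) (t : ℝ) :
    x t = y t ∧ p t = q t := by
  have hv : ContDiff ℝ 1 (fun z : ℝ × ℝ => (z.2, f z.1)) :=
    contDiff_snd.prodMk (hf.comp contDiff_fst)
  have key := eq_of_hasDerivAt_of_contDiff hv (f := fun t => (x t, p t))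
    (g := fun t => (y t, q t))
    (fun t => (h.hasDerivAt_pos t).prodMk (h.hasDerivAt_vel t))
    (fun t => (h'.hasDerivAt_pos t).prodMk (h'.hasDerivAt_vel t))
    (t₀ := t₀) (by simp [hx, hp])
  simpa using congrFun key t

end IsNewtonSolution

/-- The periods form a subgroup of ℝ with a least positive element, hence a cyclic one. -/
theorem IsMinimalPeriod.exists_int_of_periodic {α : Type*} {f : ℝ → α} {T h : ℝ}
    (hT : IsMinimalPeriod f T) (hh : Function.Periodic f h) : ∃ n : ℤ, h = n * T := by
  let H : AddSubgroup ℝ :=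
    { carrier := {c | Function.Periodic f c}
      add_mem' := fun ha hb => ha.add_period hb
      zero_mem' := fun t => by simp
      neg_mem' := fun ha => ha.neg }
  have hH : H = AddSubgroup.closure {T} :=
    AddSubgroup.cyclic_of_min ⟨⟨hT.1.2, hT.1.1⟩, fun c hc => hT.2 ⟨hc.2, hc.1⟩⟩
  have : h ∈ AddSubgroup.closure {T} := hH ▸ hh
  obtain ⟨n, hn⟩ := AddSubgroup.mem_closure_singleton.1 this
  exact ⟨n, by simpa using hn.symm⟩

/-! ### Coincidence times of oscillations and rotations -/

namespace IsNewtonSolution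

variable {f x p : ℝ → ℝ} {a T : ℝ}

/-- Time reversal about `a` and negation of `x` both give solutions, with the same data at `a`. -/
theorem apply_reflect_of_eq_zero (h : IsNewtonSolution f x p) (hf : ContDiff ℝ 1 f)
    (hodd : f.Odd) (ha : x a = 0) (t : ℝ) : x (2 * a - t) = -x t ∧ p (2 * a - t) = p t := by
  have := (h.comp_const_sub (2 * a)).unique (h.neg hodd) hf (t₀ := a)
    (by simp [two_mul, ha]) (by simp [two_mul]) t
  simpa using this

/-- A solution of an odd Newton equation through the origin takes its values twice per period. -/
theorem apply_eq_iff (h : IsNewtonSolution f x p) (hf : ContDiff ℝ 1 f) (hodd : f.Odd)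
    {K : ℝ → ℝ} (hK : ∀ t, p t ^ 2 = K (x t)) (ha : x a = 0) (hpa : p a ≠ 0)
    (hT : IsMinimalPeriod (fun t => (x t, p t)) T) (s t : ℝ) :
    x s = x t ↔ (∃ n : ℤ, t - s = n * T) ∨ ∃ n : ℤ, s + t - 2 * a = (n + 1 / 2) * T := by
  have hrefl := h.apply_reflect_of_eq_zero hf hodd ha
  have hper : ∀ (n : ℤ) r, x (r + n * T) = x r ∧ p (r + n * T) = p r := fun n r => by
    simpa using (hT.1.2.int_mul n) r
  -- Opposite velocities at equal positions make the motion symmetric about (s + t)/2. Composed with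
  -- the reflection about `a`, this makes 2a - s - t an antiperiod.
  have hrev : ∀ s t, x s = x t → p s = -p t → ∀ r, x (r + (2 * a - s - t)) = -x r ∧
      p (r + (2 * a - s - t)) = -p r := by
    intro s t hx hp r
    have h1 := (h.comp_const_sub (s + t)).unique h hf (t₀ := t) (by simpa using hx)
      (by simp [hp]) r
    have h2 := hrefl (s + t - r)
    have e : 2 * a - (s + t - r) = r + (2 * a - s - t) := by ring
    rw [e] at h2
    exact ⟨by rw [h2.1, h1.1], by rw [h2.2, ← h1.2, neg_neg]⟩
  have hhalf : ∀ s t, x s = x t → p s = -p t →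
      ∃ n : ℤ, s + t - 2 * a = (n + 1 / 2) * T := by
    intro s t hx hp
    have hr := hrev s t hx hp
    obtain ⟨n, hn⟩ := hT.exists_int_of_periodic (h := 2 * (2 * a - s - t)) fun r => by
      have e : r + 2 * (2 * a - s - t) = (r + (2 * a - s - t)) + (2 * a - s - t) := by ring
      rw [e, (hr _).1, (hr _).2, (hr r).1, (hr r).2, neg_neg, neg_neg]
    -- Twice the antiperiod is nT. For even n the antiperiod would itself be a period, forcing p a =
    -- -p a.
    rcases Int.even_or_odd' n with ⟨m, rfl | rfl⟩
    · exfalso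
      have e : 2 * a - s - t = m * T := by push_cast at hn; linarith
      have h1 := (hr a).2
      rw [e, (hper m a).2] at h1
      exact hpa (by linarith)
    · exact ⟨-m - 1, by push_cast at hn ⊢; linarith⟩
  have hanti : ∀ (n : ℤ) r, x (r + (n + 1 / 2) * T) = -x r := by
    -- Rolle gives a turning point; taking s = t = t₀ in `hrev` and `hhalf` shows that T/2 is an
    -- antiperiod.
    obtain ⟨t₀, -, ht₀⟩ := exists_hasDerivAt_eq_zero (f := x) (f' := p) (a := a) (b := a + T)
      (by linarith [hT.1.1])
      (fun t _ => (h.hasDerivAt_pos t).continuousAt.continuousWithinAt)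
      (by simpa using (hper 1 a).1.symm) (fun t _ => h.hasDerivAt_pos t)
    have hr := hrev t₀ t₀ rfl (by simp [ht₀])
    obtain ⟨m, hm⟩ := hhalf t₀ t₀ rfl (by simp [ht₀])
    intro n r
    have e : r + (n + 1 / 2) * T =
        (r + (2 * a - t₀ - t₀)) + ((n + m + 1 : ℤ) : ℝ) * T := by
      push_cast; linarith
    rw [e, (hper _ _).1, (hr r).1]
  constructor
  · intro hx
    have hp : p s ^ 2 = p t ^ 2 := by rw [hK, hK, hx]
    rcases sq_eq_sq_iff_eq_or_eq_neg.1 hp with hp | hp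
    · left
      refine hT.exists_int_of_periodic fun r => ?_
      have := (h.comp_add_const (t - s)).unique h hf (t₀ := s) (by simp [hx]) (by simp [hp]) r
      simpa using this
    · exact Or.inr (hhalf s t hx hp)
  · rintro (⟨n, hn⟩ | ⟨n, hn⟩)
    · rw [← (hper n s).1, ← hn, add_sub_cancel]
    · have h1 := hanti n (2 * a - s)
      rw [← hn, (hrefl s).1, neg_neg] at h1
      rw [← h1]
      ring_nf

theorem neg_apply_eq_iff (h : IsNewtonSolution f x p) (hf : ContDiff ℝ 1 f) (hodd : f.Odd)
    {K : ℝ → ℝ} (hK : ∀ t, p t ^ 2 = K (x t)) (ha : x a = 0) (hpa : p a ≠ 0)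
    (hT : IsMinimalPeriod (fun t => (x t, p t)) T) (s t : ℝ) :
    -x s = x t ↔ (∃ n : ℤ, s + t - 2 * a = n * T) ∨ ∃ n : ℤ, t - s = (n + 1 / 2) * T := by
  rw [← (h.apply_reflect_of_eq_zero hf hodd ha s).1, h.apply_eq_iff hf hodd hK ha hpa hT]
  have e₁ : t - (2 * a - s) = s + t - 2 * a := by ring
  have e₂ : 2 * a - s + t - 2 * a = t - s := by ring
  rw [e₁, e₂]

theorem periodic_int_mul_two_pi {f : ℝ → ℝ} (hf : f.Periodic (2 * Real.pi)) (n : ℤ) :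
    f.Periodic (2 * Real.pi * n) := by
  rw [mul_comm]
  exact hf.int_mul n

/-- A rotation, i.e. a motion on the circle without turning points, is injective on a period. -/
theorem angle_apply_eq_iff (h : IsNewtonSolution f x p) (hf : ContDiff ℝ 1 f)
    (hfp : f.Periodic (2 * Real.pi)) {K : ℝ → ℝ} (hKp : K.Periodic (2 * Real.pi))
    (hK : ∀ t, p t ^ 2 = K (x t)) (hp : ∀ t, p t ≠ 0)
    (hT : IsMinimalPeriod (fun t => ((x t : Real.Angle), p t)) T) (s t : ℝ) :
    (x s : Real.Angle) = x t ↔ ∃ n : ℤ, t - s = n * T := by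
  constructor
  · intro hx
    obtain ⟨n, hn⟩ := Real.Angle.angle_eq_iff_two_pi_dvd_sub.1 hx.symm
    have hpc : Continuous p := continuous_iff_continuousAt.2 fun t =>
      (h.hasDerivAt_vel t).continuousAt
    have hx' : x t = x s + 2 * Real.pi * n := by linarith
    have hpst : p s ^ 2 = p t ^ 2 := by
      rw [hK, hK, hx', periodic_int_mul_two_pi hKp n]
    have hps : p s = p t := by
      refine (sq_eq_sq_iff_eq_or_eq_neg.1 hpst).resolve_right fun hneg => ?_
      -- A velocity without zeros cannot change sign.
      have h0 : (0 : ℝ) ∈ range p := by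
        rcases le_total (p t) 0 with ht | ht
        · exact mem_range_of_exists_le_of_exists_ge hpc ⟨t, ht⟩ ⟨s, by linarith⟩
        · exact mem_range_of_exists_le_of_exists_ge hpc ⟨s, by linarith⟩ ⟨t, ht⟩
      exact h0.elim hp
    refine hT.exists_int_of_periodic fun r => ?_
    have h1 := (h.comp_add_const (t - s)).unique (h.add_const (periodic_int_mul_two_pi hfp n)) hf
      (t₀ := s) (by simp [hx']) (by simp [hps]) r
    simp only [Prod.mk.injEq]
    refine ⟨?_, h1.2⟩
    rw [h1.1, Real.Angle.angle_eq_iff_two_pi_dvd_sub]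
    exact ⟨n, by ring⟩
  · rintro ⟨n, hn⟩
    have := (hT.1.2.int_mul n) s
    rw [← hn, add_sub_cancel] at this
    exact (congrArg Prod.fst this).symm

/-- Since `x a` is fixed by negation on the circle, reflection about `a` turns -x s into x (2a - s),
reducing to `angle_apply_eq_iff`. -/
theorem angle_neg_apply_eq_iff (h : IsNewtonSolution f x p) (hf : ContDiff ℝ 1 f) (hodd : f.Odd)
    (hfp : f.Periodic (2 * Real.pi)) {K : ℝ → ℝ} (hKp : K.Periodic (2 * Real.pi))
    (hK : ∀ t, p t ^ 2 = K (x t)) (hp : ∀ t, p t ≠ 0) (ha : -(x a : Real.Angle) = x a)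
    (hT : IsMinimalPeriod (fun t => ((x t : Real.Angle), p t)) T) (s t : ℝ) :
    -(x s : Real.Angle) = x t ↔ ∃ n : ℤ, s + t - 2 * a = n * T := by
  rw [← Real.Angle.coe_neg] at ha ⊢
  obtain ⟨n, hn⟩ := Real.Angle.angle_eq_iff_two_pi_dvd_sub.1 ha.symm
  have h1 := ((h.comp_const_sub (2 * a)).unique
    ((h.neg hodd).add_const (periodic_int_mul_two_pi hfp n)) hf (t₀ := a)
    (by simp only [two_mul, add_sub_cancel_right]; linarith)
    (by simp [two_mul]) s).1
  have h2 : ((-x s : ℝ) : Real.Angle) = (x (2 * a - s) : ℝ) := by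
    rw [h1, Real.Angle.angle_eq_iff_two_pi_dvd_sub]
    exact ⟨-n, by push_cast; ring⟩
  rw [h2, h.angle_apply_eq_iff hf hfp hKp hK hp hT]
  have e : t - (2 * a - s) = s + t - 2 * a := by ring
  rw [e]

end IsNewtonSolution
-- Elliptic coordinates as a branched double cover
-- In complex notation the point is cos(y - ix), and the fibres of cos are ±z + 2πℤ.
theorem ellipticPoint_eq_iff {x y x' y' : ℝ} : ellipticPoint x y = ellipticPoint x' y' ↔
    (x = x' ∧ (y : Real.Angle) = y') ∨ (-x = x' ∧ -(y : Real.Angle) = y') := by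
  have hcos : ∀ u v : ℝ, Complex.cos (v + (-u : ℝ) * Complex.I) =
      ⟨(ellipticPoint u v).1, (ellipticPoint u v).2⟩ := fun u v => by
    rw [Complex.cos_add_mul_I, ← Complex.ofReal_cosh, ← Complex.ofReal_sinh,
      ← Complex.ofReal_cos, ← Complex.ofReal_sin]
    apply Complex.ext <;>
      simp [ellipticPoint, mul_comm, Complex.cos_ofReal_re, Complex.sin_ofReal_re,
        Complex.cosh_ofReal_re, Complex.sinh_ofReal_re]
  constructor
  · intro h
    have hc : Complex.cos (y + (-x : ℝ) * Complex.I) =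
        Complex.cos (y' + (-x' : ℝ) * Complex.I) := by rw [hcos, hcos, h]
    obtain ⟨n, hn | hn⟩ := Complex.cos_eq_cos_iff.1 hc
    · have h1 := congrArg Complex.re hn
      have h2 := congrArg Complex.im hn
      simp at h1 h2
      refine Or.inl ⟨h2.symm, Real.Angle.angle_eq_iff_two_pi_dvd_sub.2 ⟨-n, ?_⟩⟩
      push_cast; linarith
    · have h1 := congrArg Complex.re hn
      have h2 := congrArg Complex.im hn
      simp at h1 h2
      refine Or.inr ⟨by linarith, ?_⟩
      rw [← Real.Angle.coe_neg]
      refine Real.Angle.angle_eq_iff_two_pi_dvd_sub.2 ⟨-n, ?_⟩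
      push_cast; linarith
  · rintro (⟨rfl, hy⟩ | ⟨rfl, hy⟩)
    · rw [ellipticPoint, ellipticPoint, ← Real.Angle.cos_coe, ← Real.Angle.sin_coe, hy]
      simp
    · have h1 := congrArg Real.Angle.cos hy
      have h2 := congrArg Real.Angle.sin hy
      simp at h1 h2
      simp [ellipticPoint, h1, ← h2]

/-- The primaries are the branch points, i.e. the images of the fixed points of (x, y) ↦ (-x, -y).
-/
theorem ellipticPoint_eq_primary_iff {x y : ℝ} :
    (ellipticPoint x y = primaryE ∨ ellipticPoint x y = primaryM) ↔
      x = 0 ∧ -(y : Real.Angle) = y := by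
  have hE : primaryE = ellipticPoint 0 Real.pi := by simp [primaryE, ellipticPoint]
  have hM : primaryM = ellipticPoint 0 0 := by simp [primaryM, ellipticPoint]
  rw [hE, hM, ellipticPoint_eq_iff, ellipticPoint_eq_iff, neg_eq_zero, neg_eq_iff_eq_neg,
    Real.Angle.neg_coe_pi,
    Real.Angle.neg_eq_self_iff]
  simp
  tauto

/-! ### Counting lattice points -/

/-- The lattice points `(j, m)` with `0 < j < l`, `0 ≤ m < k` and `j / l + (m + 1 / 2) / k < 1`. -/
def latticePairs (k l : ℕ) : Finset (ℕ × ℕ) :=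
  (Finset.Ioo 0 l ×ˢ Finset.range k).filter
    fun z => 2 * z.1 * k + (2 * z.2 + 1) * l < 2 * k * l

theorem mem_latticePairs {k l : ℕ} {z : ℕ × ℕ} : z ∈ latticePairs k l ↔
    ((0 < z.1 ∧ z.1 < l) ∧ z.2 < k) ∧ 2 * z.1 * k + (2 * z.2 + 1) * l < 2 * k * l := by
  simp [latticePairs]

theorem two_mul_eq_of_dvd_two_mul_mul {k l j : ℕ} (hkl : Nat.Coprime k l) (hj : 0 < j)
    (hjl : j < l) (h : l ∣ 2 * j * k) : 2 * j = l := by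
  obtain ⟨e, he⟩ := hkl.symm.dvd_of_dvd_mul_right h
  have h1 : 0 < e := Nat.pos_of_ne_zero (by rintro rfl; omega)
  have h2 : e < 2 := by
    by_contra! h2
    have := Nat.mul_le_mul_left l h2
    omega
  obtain rfl : e = 1 := by omega
  omega

/-- The central symmetry (j, m) ↦ (l - j, k - 1 - m) of the box sends the weight w to 4kl - w,
exchanging w < 2kl and w > 2kl. Equality forces 2j = l and 2m + 1 = k; for even l, coprimality makes
k odd, so this point exists. -/
theorem card_latticePairs {k l : ℕ} (hl : 0 < l) (hkl : Nat.Coprime k l) :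
    2 * (latticePairs k l).card + (if Even l then 1 else 0) = k * (l - 1) := by
  set S := Finset.Ioo 0 l ×ˢ Finset.range k with hS
  set w : ℕ × ℕ → ℕ := fun z => 2 * z.1 * k + (2 * z.2 + 1) * l with hw
  have hcard : S.card = k * (l - 1) := by simp [hS, mul_comm]
  have hlt : latticePairs k l = S.filter fun z => w z < 2 * k * l := rfl
  have hgt : (S.filter fun z => 2 * k * l < w z).card = (latticePairs k l).card := by
    have hmem : ∀ z ∈ S, (l - z.1, k - 1 - z.2) ∈ S ∧
        w (l - z.1, k - 1 - z.2) + w z = 4 * k * l := by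
      rintro ⟨j, m⟩ hz
      simp only [hS, Finset.mem_product, Finset.mem_Ioo, Finset.mem_range] at hz ⊢
      refine ⟨by omega, ?_⟩
      obtain ⟨i, rfl⟩ := Nat.exists_eq_add_of_lt hz.1.2
      obtain ⟨n, rfl⟩ := Nat.exists_eq_add_of_lt hz.2
      have e1 : j + i + 1 - j = i + 1 := by omega
      have e2 : m + n + 1 - 1 - m = n := by omega
      simp only [hw, e1, e2]
      ring
    rw [hlt]
    refine Finset.card_nbij' (fun z => (l - z.1, k - 1 - z.2)) (fun z => (l - z.1, k - 1 - z.2))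
      ?_ ?_ ?_ ?_
    · intro z hz
      rw [Finset.mem_coe, Finset.mem_filter] at hz ⊢
      have := hmem z hz.1
      exact ⟨this.1, by linarith [hz.2, this.2]⟩
    · intro z hz
      rw [Finset.mem_coe, Finset.mem_filter] at hz ⊢
      have := hmem z hz.1
      exact ⟨this.1, by linarith [hz.2, this.2]⟩
    all_goals
      rintro ⟨j, m⟩ hz
      simp only [hS, Finset.mem_coe, Finset.mem_filter, Finset.mem_product, Finset.mem_Ioo,
        Finset.mem_range] at hz
      simp only [Prod.mk.injEq]
      omega
  have heq : (S.filter fun z => w z = 2 * k * l).card = if Even l then 1 else 0 := by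
    have hmem : ∀ z ∈ S, w z = 2 * k * l → 2 * z.1 = l ∧ k = 2 * z.2 + 1 := by
      rintro ⟨j, m⟩ hz he
      simp only [hS, Finset.mem_product, Finset.mem_Ioo, Finset.mem_range] at hz
      simp only [hw] at he
      have hd : l ∣ 2 * j * k :=
        (Nat.dvd_add_left (Dvd.intro_left (2 * m + 1) rfl)).1 (he ▸ Dvd.intro_left (2 * k) rfl)
      have h1 := two_mul_eq_of_dvd_two_mul_mul hkl hz.1.1 hz.1.2 hd
      refine ⟨h1, ?_⟩
      rw [h1] at he
      have : (k + (2 * m + 1)) * l = 2 * k * l := by linarith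
      have := Nat.eq_of_mul_eq_mul_right hl this
      show k = 2 * m + 1
      omega
    split_ifs with he
    · obtain ⟨j, rfl⟩ := he
      have hk : Odd k := by
        rcases Nat.even_or_odd k with hk | hk
        · exact absurd hkl (Nat.not_coprime_of_dvd_of_dvd one_lt_two hk.two_dvd
            (Even.add_self j).two_dvd)
        · exact hk
      obtain ⟨m, rfl⟩ := hk
      rw [Finset.card_eq_one]
      refine ⟨(j, m), Finset.ext fun z => ?_⟩
      rw [Finset.mem_filter, Finset.mem_singleton]
      constructor
      · rintro ⟨h1, h2⟩
        have := hmem z h1 h2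
        ext <;> omega
      · rintro rfl
        simp only [hS, hw, Finset.mem_product, Finset.mem_Ioo, Finset.mem_range]
        refine ⟨by omega, by ring⟩
    · rw [Finset.card_eq_zero, Finset.filter_eq_empty_iff]
      intro z hz h
      exact he ⟨z.1, by have := hmem z hz h; omega⟩
  rw [← hcard, ← Finset.card_filter_add_card_filter_not (s := S) (fun z => w z < 2 * k * l),
    ← hlt, ← heq]
  have hsplit : (S.filter fun z => ¬ w z < 2 * k * l) =
      (S.filter fun z => 2 * k * l < w z) ∪ (S.filter fun z => w z = 2 * k * l) := by
    ext z
    simp only [Finset.mem_filter, Finset.mem_union]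
    constructor
    · rintro ⟨h1, h2⟩
      rcases (not_lt.1 h2).lt_or_eq with h | h
      · exact Or.inl ⟨h1, h⟩
      · exact Or.inr ⟨h1, h.symm⟩
    · rintro (⟨h1, h2⟩ | ⟨h1, h2⟩)
      · exact ⟨h1, by omega⟩
      · exact ⟨h1, by omega⟩
  rw [hsplit, Finset.card_union_of_disjoint, hgt]
  · ring
  · rw [Finset.disjoint_filter]
    intro z _ h1 h2
    omega

/-! ### From the trajectory to arithmetic of times -/

/-- The collision times of `γ` are the points of `a + (k l τ / 2) ℤ`, and `γ` visits a point of the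
`q`-plane at two times `s`, `t` precisely if the elliptic coordinates at these times agree up to a
simultaneous sign; here `l τ` is the period of the motion in `λ` and `k τ` that of the motion
in `ν`. -/
structure PhaseCurve.HasTorusTimes (γ : PhaseCurve) (k l : ℕ) (τ a : ℝ) : Prop where
  pos_eq_iff : ∀ s t, γ.pos s = γ.pos t ↔
    ((∃ n : ℤ, t - s = n * (k * τ)) ∧
      ((∃ n : ℤ, t - s = n * (l * τ)) ∨ ∃ n : ℤ, s + t - 2 * a = (n + 1 / 2) * (l * τ))) ∨
    ((∃ n : ℤ, s + t - 2 * a = n * (k * τ)) ∧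
      ((∃ n : ℤ, s + t - 2 * a = n * (l * τ)) ∨ ∃ n : ℤ, t - s = (n + 1 / 2) * (l * τ)))
  collidesAt_iff : ∀ t, γ.CollidesAt t ↔ ∃ n : ℤ, t - a = n * (k * l * τ / 2)

theorem IsTrajectory.isNewtonSolution_lam {μ c : ℝ} {γ : PhaseCurve} (hγ : IsTrajectory μ c γ) :
    IsNewtonSolution (fun x => Real.sinh x + 2 * c * Real.cosh x * Real.sinh x)
      γ.lam γ.plam := by
  refine ⟨fun t => ?_, fun t => ?_⟩
  · convert hγ.hasDerivAt_lam t using 1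
    refine (HasDerivAt.deriv ?_).symm
    unfold F Flam
    have := ((((hasDerivAt_id (γ.plam t)).pow 2).div_const 2).sub_const
      (Real.cosh (γ.lam t))).sub_const (c * Real.cosh (γ.lam t) ^ 2)
    convert! this.add_const (Fnu μ c (γ.nu t) (γ.pnu t)) using 1
    simp
  · convert hγ.hasDerivAt_plam t using 1
    rw [eq_neg_iff_add_eq_zero, add_comm, ← eq_neg_iff_add_eq_zero]
    refine HasDerivAt.deriv ?_
    unfold F Flam
    have := ((Real.hasDerivAt_cosh (γ.lam t)).const_sub (γ.plam t ^ 2 / 2)).sub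
      (((Real.hasDerivAt_cosh (γ.lam t)).pow 2).const_mul c)
    convert! this.add_const (Fnu μ c (γ.nu t) (γ.pnu t)) using 1
    simp
    ring

theorem IsTrajectory.isNewtonSolution_nu {μ c : ℝ} {γ : PhaseCurve} (hγ : IsTrajectory μ c γ) :
    IsNewtonSolution (fun y => (1 - 2 * μ) * Real.sin y + 2 * c * Real.cos y * Real.sin y)
      γ.nu γ.pnu := by
  refine ⟨fun t => ?_, fun t => ?_⟩
  · convert hγ.hasDerivAt_nu t using 1
    refine (HasDerivAt.deriv ?_).symm
    unfold F Fnu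
    have := ((((hasDerivAt_id (γ.pnu t)).pow 2).div_const 2).add_const
      ((1 - 2 * μ) * Real.cos (γ.nu t))).add_const (c * Real.cos (γ.nu t) ^ 2)
    convert! this.const_add (Flam c (γ.lam t) (γ.plam t)) using 1
    simp
  · convert hγ.hasDerivAt_pnu t using 1
    rw [eq_neg_iff_add_eq_zero, add_comm, ← eq_neg_iff_add_eq_zero]
    refine HasDerivAt.deriv ?_
    unfold F Fnu
    have := (((Real.hasDerivAt_cos (γ.nu t)).const_mul (1 - 2 * μ)).const_add
      (γ.pnu t ^ 2 / 2)).add (((Real.hasDerivAt_cos (γ.nu t)).pow 2).const_mul c)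
    convert! this.const_add (Flam c (γ.lam t) (γ.plam t)) using 1
    simp
    ring

theorem exists_int_mul_of_mul_eq_mul {k l : ℕ} (hkl : Nat.Coprime k l) (hk : 0 < k)
    {m n : ℤ} (h : m * l = n * k) : ∃ r : ℤ, m = r * k ∧ n = r * l := by
  have hd : (k : ℤ) ∣ m :=
    (Nat.isCoprime_iff_coprime.2 hkl).dvd_of_dvd_mul_right (h ▸ Dvd.intro_left n rfl)
  obtain ⟨r, rfl⟩ := hd
  refine ⟨r, mul_comm _ _, ?_⟩
  have hk' : (k : ℤ) ≠ 0 := by exact_mod_cast hk.ne'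
  apply mul_right_cancel₀ hk'
  rw [← h]
  ring

theorem IsTrajectory.exists_hasTorusTimes {μ c : ℝ} {k l : ℕ} (hk : 0 < k) (hl : 0 < l)
    (hkl : Nat.Coprime k l) {γ : PhaseCurve} (hγ : IsTrajectory μ c γ)
    (hL : IsLemniscate μ c γ) (hT : LiesOnTorus k l γ) {a : ℝ} (ha : γ.CollidesAt a) :
    ∃ τ, 0 < τ ∧ γ.HasTorusTimes k l τ a := by
  obtain ⟨g, hg, ⟨x₀, hx₀, -, hKl⟩, hKn⟩ := hL
  obtain ⟨Tl, Tn, hTl, hTn, hR⟩ := hT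
  have hk' : (0 : ℝ) < k := by exact_mod_cast hk
  have hl' : (0 : ℝ) < l := by exact_mod_cast hl
  obtain ⟨τ, rfl, rfl⟩ : ∃ τ, Tn = k * τ ∧ Tl = l * τ := by
    have := hTl.1.1
    refine ⟨Tl / l, ?_, by field_simp⟩
    field_simp at hR ⊢
    linarith
  have hτ : 0 < τ := pos_of_mul_pos_right hTl.1.1 hl'.le
  have hcl : ContDiff ℝ 1 (fun x => Real.sinh x + 2 * c * Real.cosh x * Real.sinh x) :=
    Real.contDiff_sinh.add ((contDiff_const.mul Real.contDiff_cosh).mul Real.contDiff_sinh)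
  have hcn : ContDiff ℝ 1
      (fun y => (1 - 2 * μ) * Real.sin y + 2 * c * Real.cos y * Real.sin y) :=
    (contDiff_const.mul Real.contDiff_sin).add
      ((contDiff_const.mul Real.contDiff_cos).mul Real.contDiff_sin)
  have hol : (fun x => Real.sinh x + 2 * c * Real.cosh x * Real.sinh x).Odd := fun x => by
    simp; ring
  have hon : (fun y => (1 - 2 * μ) * Real.sin y + 2 * c * Real.cos y * Real.sin y).Odd :=
    fun x => by simp; ring
  have hpl : ∀ t, γ.plam t ^ 2 = 2 * kineticLam c g (γ.lam t) := fun t => by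
    have h1 := hγ.level t
    rw [F, hg t] at h1
    simp only [kineticLam, Flam] at h1 ⊢
    linarith
  have hpn : ∀ t, γ.pnu t ^ 2 = 2 * kineticNu μ c g (γ.nu t) := fun t => by
    have h1 := hg t
    simp only [kineticNu, Fnu] at h1 ⊢
    linarith
  have hfp : (fun y => (1 - 2 * μ) * Real.sin y + 2 * c * Real.cos y * Real.sin y).Periodic
      (2 * Real.pi) := fun y => by simp
  have hKp : (fun y => 2 * kineticNu μ c g y).Periodic (2 * Real.pi) := fun y => by
    simp [kineticNu, Fnu]
  have hpn0 : ∀ t, γ.pnu t ≠ 0 := fun t h0 => by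
    have h1 := hpn t
    rw [h0] at h1
    linarith [hKn (γ.nu t)]
  obtain ⟨hla, hna⟩ := ellipticPoint_eq_primary_iff.1 ha
  have hpla : γ.plam a ≠ 0 := fun h0 => by
    have h1 := hpl a
    rw [h0, hla] at h1
    linarith [hKl 0 ⟨by linarith, hx₀⟩]
  have hlam := hγ.isNewtonSolution_lam.apply_eq_iff hcl hol
    (K := fun x => 2 * kineticLam c g x) hpl hla hpla hTl
  have hlam' := hγ.isNewtonSolution_lam.neg_apply_eq_iff hcl hol
    (K := fun x => 2 * kineticLam c g x) hpl hla hpla hTl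
  have hnu := hγ.isNewtonSolution_nu.angle_apply_eq_iff hcn hfp hKp hpn hpn0 hTn
  have hnu' := hγ.isNewtonSolution_nu.angle_neg_apply_eq_iff hcn hon hfp hKp hpn hpn0 hna hTn
  refine ⟨τ, hτ, fun s t => ?_, fun t => ?_⟩
  · rw [PhaseCurve.pos, PhaseCurve.pos, ellipticPoint_eq_iff, hlam, hlam', hnu, hnu', and_comm,
      and_comm (b := ∃ n : ℤ, s + t - 2 * a = n * (k * τ))]
  -- A collision at t means λ(t) = λ(a) and -ν(t) = ν(t), so both conditions are coincidence
  -- relations already solved.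
  · rw [PhaseCurve.CollidesAt, PhaseCurve.pos, ellipticPoint_eq_primary_iff, hnu', ← hla,
      eq_comm, hlam]
    constructor
    · rintro ⟨h1, n, hn⟩
      have h2 : ∃ m : ℤ, 2 * (t - a) = m * (l * τ) := by
        rcases h1 with ⟨m, hm⟩ | ⟨m, hm⟩
        · exact ⟨2 * m, by push_cast; linarith⟩
        · exact ⟨2 * m + 1, by push_cast; linarith⟩
      obtain ⟨m, hm⟩ := h2
      have h3 : m * l = n * k := by
        have : (m * l : ℝ) * τ = (n * k) * τ := by linarith
        exact_mod_cast mul_right_cancel₀ hτ.ne' this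
      obtain ⟨r, rfl, rfl⟩ := exists_int_mul_of_mul_eq_mul hkl hk h3
      exact ⟨r, by push_cast at hm; linarith⟩
    · rintro ⟨n, hn⟩
      refine ⟨?_, n * l, by push_cast; linarith⟩
      -- The parity of nk decides whether λ crosses 0 in the same direction as at `a` or half a
      -- period later.
      rcases Int.even_or_odd' (n * k) with ⟨m, hm | hm⟩
      · have hm' : (n * k : ℝ) = 2 * m := by exact_mod_cast hm
        exact Or.inl ⟨m, by linear_combination hn + l * τ / 2 * hm'⟩
      · have hm' : (n * k : ℝ) = 2 * m + 1 := by exact_mod_cast hm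
        exact Or.inr ⟨m, by linear_combination hn + l * τ / 2 * hm'⟩

/-! ### Self-intersections as lattice points -/

namespace PhaseCurve.HasTorusTimes

variable {γ : PhaseCurve} {k l : ℕ} {τ a : ℝ}

theorem pos_add_period (H : γ.HasTorusTimes k l τ a) (n : ℤ) (t : ℝ) :
    γ.pos (t + n * (k * l * τ)) = γ.pos t := by
  rw [eq_comm, H.pos_eq_iff]
  exact Or.inl ⟨⟨n * l, by push_cast; ring⟩, Or.inl ⟨n * k, by push_cast; ring⟩⟩

theorem pos_reflect (H : γ.HasTorusTimes k l τ a) (n : ℤ) (t : ℝ) :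
    γ.pos (2 * a + n * (k * l * τ) - t) = γ.pos t := by
  rw [H.pos_eq_iff]
  exact Or.inr ⟨⟨n * l, by push_cast; ring⟩, Or.inl ⟨n * k, by push_cast; ring⟩⟩

theorem not_collidesAt (H : γ.HasTorusTimes k l τ a) {t : ℝ} (h₁ : a < t)
    (h₂ : t < a + k * l * τ / 2) : ¬ γ.CollidesAt t := by
  rw [H.collidesAt_iff]
  rintro ⟨n, hn⟩
  have hpos : 0 < k * l * τ / 2 := by linarith
  have h3 : (0 : ℝ) < n := pos_of_mul_pos_left (by linarith) hpos.le
  have h4 : (n : ℝ) < 1 := by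
    by_contra! h
    have := mul_le_mul_of_nonneg_right h hpos.le
    linarith
  have h5 : (0 : ℤ) < n := by exact_mod_cast h3
  have h6 : n < (1 : ℤ) := by exact_mod_cast h4
  omega

/-- Every self-intersection point is visited twice on the arc that starts at the collision at
time `a`. -/
theorem mem_selfIntersectionPoints_iff (H : γ.HasTorusTimes k l τ a) (hk : 0 < k) (hl : 0 < l)
    (hτ : 0 < τ) {q : ℝ × ℝ} : q ∈ γ.selfIntersectionPoints ↔
      ∃ s t, a < s ∧ s < t ∧ t < a + k * l * τ / 2 ∧ γ.pos s = q ∧ γ.pos t = q := by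
  have hk' : (0 : ℝ) < k := by exact_mod_cast hk
  have hl' : (0 : ℝ) < l := by exact_mod_cast hl
  set A := k * l * τ / 2 with hA
  have hA0 : 0 < A := by positivity
  constructor
  · rintro ⟨s, t, hst, hs, ht, hcol⟩
    obtain ⟨n, hn⟩ : ∃ n : ℤ, n = ⌊(s - a) / A⌋ := ⟨_, rfl⟩
    have h1 : n * A ≤ s - a := by
      rw [← le_div_iff₀ hA0, hn]; exact Int.floor_le _
    have h2 : s - a < (n + 1) * A := by
      rw [← div_lt_iff₀ hA0, hn]; exact Int.lt_floor_add_one _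
    have h3 : n * A ≠ s - a := fun h =>
      hcol s ⟨le_rfl, hst.le⟩ ((H.collidesAt_iff s).2 ⟨n, h.symm⟩)
    have h4 : t - a < (n + 1) * A := by
      by_contra! h
      refine hcol (a + (n + 1) * A) ⟨by linarith, by linarith⟩ ((H.collidesAt_iff _).2 ⟨n + 1, ?_⟩)
      push_cast; ring
    have h5 := lt_of_le_of_ne h1 h3
    -- Here n is the index of the arc containing s and t. Even arcs are translates of the first one;
    -- odd arcs are brought to it by a reflection, which swaps the order of s and t.
    rcases Int.even_or_odd' n with ⟨m, rfl | rfl⟩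
    · push_cast at h5 h4
      refine ⟨s + (-m : ℤ) * (k * l * τ), t + (-m : ℤ) * (k * l * τ), ?_, ?_, ?_, ?_, ?_⟩
      · push_cast; rw [hA] at h5 h4; linarith
      · linarith
      · push_cast; rw [hA] at h5 h4 ⊢; linarith
      · rw [H.pos_add_period, hs]
      · rw [H.pos_add_period, ht]
    · push_cast at h5 h4
      refine ⟨2 * a + (m + 1 : ℤ) * (k * l * τ) - t, 2 * a + (m + 1 : ℤ) * (k * l * τ) - s,
        ?_, ?_, ?_, ?_, ?_⟩
      · push_cast; rw [hA] at h5 h4; linarith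
      · linarith
      · push_cast; rw [hA] at h5 h4 ⊢; linarith
      · rw [H.pos_reflect, ht]
      · rw [H.pos_reflect, hs]
  · rintro ⟨s, t, h1, hst, h2, hs, ht⟩
    exact ⟨s, t, hst, hs, ht, fun r hr =>
      H.not_collidesAt (by linarith [hr.1]) (by linarith [hr.2])⟩

theorem selfIntersectionPoints_eq (H : γ.HasTorusTimes k l τ a) (hk : 0 < k) (hl : 0 < l)
    (hkl : Nat.Coprime k l) (hτ : 0 < τ) : γ.selfIntersectionPoints =
      (fun z : ℕ × ℕ => γ.pos (a + τ * (2 * z.1 * k + (2 * z.2 + 1) * l) / 4)) ''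
        (latticePairs k l : Set (ℕ × ℕ)) := by
  have hk' : (0 : ℝ) < k := by exact_mod_cast hk
  have hl' : (0 : ℝ) < l := by exact_mod_cast hl
  -- Summing t - s and s + t - 2a gives 2(t - a), so the two kinds of crossing lead to the same
  -- formula for the later time.
  have hpair : ∀ (j m : ℤ) (t : ℝ), 0 < (j : ℝ) * (k * τ) → 0 < (m + 1 / 2 : ℝ) * (l * τ) →
      t < a + k * l * τ / 2 → 2 * (t - a) = j * (k * τ) + (m + 1 / 2) * (l * τ) →
      γ.pos t ∈ (fun z : ℕ × ℕ => γ.pos (a + τ * (2 * z.1 * k + (2 * z.2 + 1) * l) / 4)) ''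
        (latticePairs k l : Set (ℕ × ℕ)) := by
    intro j m t hj hm ht he
    have hj0 : (0 : ℝ) < j := pos_of_mul_pos_left hj (by positivity)
    have hm0 : (0 : ℝ) < m + 1 / 2 := pos_of_mul_pos_left hm (by positivity)
    have hj1 : 0 < j := by exact_mod_cast hj0
    have hm1 : 0 ≤ m := by
      have : (-1 : ℝ) < m := by linarith
      have : (-1 : ℤ) < m := by exact_mod_cast this
      omega
    lift j to ℕ using hj1.le
    lift m to ℕ using hm1
    have hsum : 2 * j * k + (2 * m + 1) * l < 2 * k * l := by
      have h1 : (2 * j * k + (2 * m + 1) * l : ℝ) * τ < (2 * k * l) * τ := by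
        push_cast at he
        linarith
      exact_mod_cast lt_of_mul_lt_mul_right h1 hτ.le
    have hjl : j < l := by
      refine lt_of_mul_lt_mul_left (a := 2 * k) ?_ (Nat.zero_le _)
      have : 0 < (2 * m + 1) * l := by positivity
      linarith
    have hmk : m < k := by
      have h1 : (2 * m + 1) * l < (2 * k) * l := by
        have : 0 < 2 * j * k := by
          have : 0 < j := by exact_mod_cast hj1
          positivity
        linarith
      have := lt_of_mul_lt_mul_right h1 (Nat.zero_le _)
      omega
    refine ⟨(j, m), mem_latticePairs.2 ⟨⟨⟨by exact_mod_cast hj1, hjl⟩, hmk⟩, hsum⟩, ?_⟩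
    have : t = a + τ * (2 * j * k + (2 * m + 1) * l) / 4 := by
      push_cast at he
      linarith
    simp only [this]
  ext q
  rw [H.mem_selfIntersectionPoints_iff hk hl hτ]
  constructor
  · rintro ⟨s, t, has, hst, ht, hs, rfl⟩
    -- A common multiple of kτ and lτ is a multiple of klτ by coprimality, too large for either time
    -- combination on one open arc.
    have hfar : ∀ (r : ℝ) (m n : ℤ), 0 < r → r < k * l * τ → r = n * (k * τ) →
        r ≠ m * (l * τ) := by
      intro r m n h0 h1 hn hm
      have h3 : m * l = n * k := by
        have : (m * l : ℝ) * τ = (n * k) * τ := by linarith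
        exact_mod_cast mul_right_cancel₀ hτ.ne' this
      obtain ⟨i, rfl, rfl⟩ := exists_int_mul_of_mul_eq_mul hkl hk h3
      push_cast at hm
      refine H.not_collidesAt (t := a + r / 2) (by linarith) (by linarith) ?_
      exact (H.collidesAt_iff _).2 ⟨i, by rw [hm]; ring⟩
    rcases (H.pos_eq_iff s t).1 hs with ⟨⟨j, hj⟩, ⟨m, hm⟩ | ⟨m, hm⟩⟩ | ⟨⟨j, hj⟩, ⟨m, hm⟩ | ⟨m, hm⟩⟩
    · exact absurd hm (hfar _ m j (by linarith) (by linarith) hj)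
    · exact hpair j m t (by linarith) (by linarith) ht (by linarith)
    · exact absurd hm (hfar _ m j (by linarith) (by linarith) hj)
    · exact hpair j m t (by linarith) (by linarith) ht (by linarith)
  · rintro ⟨⟨j, m⟩, hz, rfl⟩
    rw [Finset.mem_coe, mem_latticePairs] at hz
    obtain ⟨⟨⟨hj0, hjl⟩, hmk⟩, hsum⟩ := hz
    simp only at hj0 hjl hmk hsum
    have hsumR : (2 * j * k + (2 * m + 1) * l : ℝ) < 2 * k * l := by exact_mod_cast hsum
    have hj0R : (0 : ℝ) < 2 * j * k := by positivity
    have hm0R : (0 : ℝ) < (2 * m + 1) * l := by positivity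
    have htau := mul_lt_mul_of_pos_left hsumR hτ
    have htj := mul_pos hτ hj0R
    have htm := mul_pos hτ hm0R
    -- Equality would put the earlier time at the collision `a`; it forces 2j = l and hence weight
    -- exactly 2kl, which is excluded.
    have hne : 2 * j * k ≠ (2 * m + 1) * l := by
      intro h
      have h1 := two_mul_eq_of_dvd_two_mul_mul hkl hj0 hjl (h ▸ Dvd.intro_left _ rfl)
      have h2 : 2 * (2 * j * k) = 2 * k * l := by rw [h1]; ring
      omega
    -- The smaller of the two terms belongs to t - s. If it is 2jk, the elliptic coordinates agree
    -- at s and t; otherwise they agree after negation.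
    rcases lt_or_gt_of_ne hne with hlt | hlt
    · have hltR : (2 * j * k : ℝ) < (2 * m + 1) * l := by exact_mod_cast hlt
      have hltt := mul_lt_mul_of_pos_left hltR hτ
      refine ⟨a + τ * ((2 * m + 1) * l - 2 * j * k) / 4,
        a + τ * (2 * j * k + (2 * m + 1) * l) / 4, ?_, ?_, ?_, ?_, rfl⟩
      · linarith
      · linarith
      · linarith
      · rw [H.pos_eq_iff]
        exact Or.inl ⟨⟨j, by push_cast; ring⟩, Or.inr ⟨m, by push_cast; ring⟩⟩
    · have hltR : ((2 * m + 1) * l : ℝ) < 2 * j * k := by exact_mod_cast hlt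
      have hltt := mul_lt_mul_of_pos_left hltR hτ
      refine ⟨a + τ * (2 * j * k - (2 * m + 1) * l) / 4,
        a + τ * (2 * j * k + (2 * m + 1) * l) / 4, ?_, ?_, ?_, ?_, rfl⟩
      · linarith
      · linarith
      · linarith
      · rw [H.pos_eq_iff]
        exact Or.inr ⟨⟨j, by push_cast; ring⟩, Or.inr ⟨m, by push_cast; ring⟩⟩

/-- No point is visited more than twice on an arc between consecutive collisions. -/
theorem injOn_latticePairs (H : γ.HasTorusTimes k l τ a) (hk : 0 < k) (hl : 0 < l)
    (hkl : Nat.Coprime k l) (hτ : 0 < τ) :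
    InjOn (fun z : ℕ × ℕ => γ.pos (a + τ * (2 * z.1 * k + (2 * z.2 + 1) * l) / 4))
      (latticePairs k l : Set (ℕ × ℕ)) := by
  have hodd : ¬ (Even (k : ℤ) ∧ Even (l : ℤ)) := by
    rintro ⟨h1, h2⟩
    exact absurd hkl (Nat.not_coprime_of_dvd_of_dvd one_lt_two
      (by exact_mod_cast h1.two_dvd) (by exact_mod_cast h2.two_dvd))
  have hco : IsCoprime (k : ℤ) (l : ℤ) := Nat.isCoprime_iff_coprime.2 hkl
  have hkZ : (0 : ℤ) < k := by exact_mod_cast hk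
  have hlZ : (0 : ℤ) < l := by exact_mod_cast hl
  have hzero : ∀ (b e : ℤ), 0 < b → -b < e → e < b → b ∣ e → e = 0 := fun b e hb h1 h2 hd =>
    Int.eq_zero_of_abs_lt_dvd hd (abs_lt.2 ⟨h1, h2⟩)
  have hself : ∀ (b e : ℤ), 0 < b → 0 < e → e < 2 * b → b ∣ e → e = b := fun b e hb h1 h2 hd => by
    have := hzero b (e - b) hb (by linarith) (by linarith) (dvd_sub_self_right.2 hd)
    linarith
  rintro ⟨j, m⟩ hz ⟨j', m'⟩ hz' heq
  rw [Finset.mem_coe, mem_latticePairs] at hz hz'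
  obtain ⟨⟨⟨hj0, hjl⟩, hmk⟩, hsum⟩ := hz
  obtain ⟨⟨⟨hj0', hjl'⟩, hmk'⟩, hsum'⟩ := hz'
  simp only at hj0 hjl hmk hsum hj0' hjl' hmk' hsum' heq
  zify at hj0 hjl hmk hsum hj0' hjl' hmk' hsum'
  have cast : ∀ u v : ℤ, (u : ℝ) * τ = v * τ → u = v := fun u v h => by
    exact_mod_cast mul_right_cancel₀ hτ.ne' h
  suffices (j : ℤ) = j' ∧ (m : ℤ) = m' by
    ext
    · exact_mod_cast this.1
    · exact_mod_cast this.2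
  -- Each relation, reduced modulo k or l and combined with the size bounds, fixes a sum or
  -- difference of the indices. Besides the case of equal indices, either k and l are both even, or
  -- the two weights sum to 4kl although each is below 2kl.
  rcases (H.pos_eq_iff _ _).1 heq with ⟨⟨n, hn⟩, h⟩ | ⟨⟨n, hn⟩, h⟩
  · have e₁ : ((j' - j) * k + (m' - m) * l : ℤ) = 2 * n * k :=
      cast _ _ (by push_cast; linear_combination 2 * hn)
    have hm : (m' - m : ℤ) = 0 := by
      refine hzero k _ hkZ (by omega) (by omega) (hco.dvd_of_dvd_mul_right ?_)
      exact ⟨2 * n - (j' - j), by linear_combination e₁⟩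
    rw [hm, zero_mul, add_zero] at e₁
    have hj : (j' - j : ℤ) = 2 * n := mul_right_cancel₀ hkZ.ne' e₁
    rcases h with ⟨r, hr⟩ | ⟨r, hr⟩
    · have e₂ : ((j' - j) * k + (m' - m) * l : ℤ) = 2 * r * l :=
        cast _ _ (by push_cast; linear_combination 2 * hr)
      rw [hm, zero_mul, add_zero] at e₂
      have := hzero l (j' - j) hlZ (by omega) (by omega)
        (hco.symm.dvd_of_dvd_mul_right ⟨2 * r, by linear_combination e₂⟩)
      omega
    · exfalso
      have e₂ : ((j + j') * k + (m + m' + 1) * l : ℤ) = (2 * r + 1) * l :=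
        cast _ _ (by push_cast; linear_combination 2 * hr)
      have hjj := hself l (j + j') hlZ (by omega) (by omega)
        (hco.symm.dvd_of_dvd_mul_right ⟨2 * r + 1 - (m + m' + 1), by linear_combination e₂⟩)
      rw [hjj] at e₂
      have e₃ : (k + (m + m' + 1) : ℤ) = 2 * r + 1 :=
        mul_right_cancel₀ hlZ.ne' (by linear_combination e₂)
      exact hodd ⟨⟨r - m, by omega⟩, ⟨j + n, by omega⟩⟩
  · have e₁ : ((j + j') * k + (m + m' + 1) * l : ℤ) = 2 * n * k :=
      cast _ _ (by push_cast; linear_combination 2 * hn)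
    have hm : (m + m' + 1 : ℤ) = k := by
      refine hself k _ hkZ (by omega) (by omega) (hco.dvd_of_dvd_mul_right ?_)
      exact ⟨2 * n - (j + j'), by linear_combination e₁⟩
    rw [hm] at e₁
    have hj : (j + j' + l : ℤ) = 2 * n :=
      mul_right_cancel₀ hkZ.ne' (by linear_combination e₁)
    exfalso
    rcases h with ⟨r, hr⟩ | ⟨r, hr⟩
    · have e₂ : ((j + j') * k + (m + m' + 1) * l : ℤ) = 2 * r * l :=
        cast _ _ (by push_cast; linear_combination 2 * hr)
      have hjj := hself l (j + j') hlZ (by omega) (by omega)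
        (hco.symm.dvd_of_dvd_mul_right ⟨2 * r - (m + m' + 1), by linear_combination e₂⟩)
      have : (2 * j * k + (2 * m + 1) * l + (2 * j' * k + (2 * m' + 1) * l) : ℤ) = 4 * k * l := by
        linear_combination 2 * k * hjj + 2 * l * hm
      linarith
    · have e₂ : ((j' - j) * k + (m' - m) * l : ℤ) = (2 * r + 1) * l :=
        cast _ _ (by push_cast; linear_combination 2 * hr)
      have hjj := hzero l (j' - j) hlZ (by omega) (by omega)
        (hco.symm.dvd_of_dvd_mul_right ⟨2 * r + 1 - (m' - m), by linear_combination e₂⟩)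
      rw [hjj, zero_mul, zero_add] at e₂
      have e₃ : (m' - m : ℤ) = 2 * r + 1 := mul_right_cancel₀ hlZ.ne' e₂
      exact hodd ⟨⟨m + r + 1, by omega⟩, ⟨n - j, by omega⟩⟩

end PhaseCurve.HasTorusTimes

end EulerProblem

theorem proposition4p1 (μ c : ℝ) (hμ₀ : 0 < μ) (hμ₁ : μ < 1) (hc : c < 0)
    (k l : ℕ) (hk : 0 < k) (hl : 0 < l) (hkl : Nat.Coprime k l)
    (γ : EulerProblem.PhaseCurve)
    (hγ : EulerProblem.IsTrajectory μ c γ)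
    (hL : EulerProblem.IsLemniscate μ c γ)
    (hT : EulerProblem.LiesOnTorus k l γ)
    (hK : EulerProblem.IsCollisionCollision γ) :
    γ.selfIntersectionPoints.Finite ∧
    (Even l → (γ.selfIntersectionPoints.ncard : ℚ) = (k : ℚ) * ((l : ℚ) - 1) / 2 - 1 / 2) ∧
    (Odd l → (γ.selfIntersectionPoints.ncard : ℚ) = (k : ℚ) * ((l : ℚ) - 1) / 2) := by
  obtain ⟨-, -, a, -, -, -, ha, -⟩ := hK
  obtain ⟨τ, hτ, H⟩ := hγ.exists_hasTorusTimes hk hl hkl hL hT ha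
  have hcard := EulerProblem.card_latticePairs hl hkl
  rw [H.selfIntersectionPoints_eq hk hl hkl hτ,
    (H.injOn_latticePairs hk hl hkl hτ).ncard_image, Set.ncard_coe_finset]
  refine ⟨(Finset.finite_toSet _).image _, fun he => ?_, fun ho => ?_⟩
  · rw [if_pos he] at hcard
    have := congrArg (Nat.cast : ℕ → ℚ) hcard
    push_cast [Nat.cast_sub (Nat.succ_le_of_lt hl)] at this
    linarith
  · rw [if_neg (Nat.not_even_iff_odd.2 ho)] at hcard
    have := congrArg (Nat.cast : ℕ → ℚ) hcard
    push_cast [Nat.cast_sub (Nat.succ_le_of_lt hl)] at this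
    linarith
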